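/- Let $M$ be a matroid with finite ground set $\mathcal P$, of rank $n$. Call two circuits of $M$ of size less than $n+1$ equivalent if they have the same closure; the equivalence classes $l$ are called the subspaces of $M$. A point $p\in\mathcal P$ belongs to $l$ if $p\in C$ for some circuit $C\in l$, and $\operatorname{rank}(l)$ is the common rank of the circuits $C\in l$. Let $\mathcal L_p$ be the set of subspaces containing $p$, let $$a_p=\sum_{l\in\mathcal L_p}\operatorname{rank}(l)-n\,(|\mathcal L_p|-1),\qquad P_M=\{p\in\mathcal P:\ a_p\le 0\}.$$ Define a chain of submatroids by $M^0=M$ and $M^{j+1}=P_{M^j}$ (the restriction of $M^j$ to the set $P_{M^j}$, where $P_{M^j}$ is computed in the matroid $M^j$ with its own rank). $M$ is called solvable if $M^j=\emptyset$ for some $j$. Let $\Gamma_M\subset(\mathbb C^n)^{\mathcal P}$ be the space of realizations of $M$: the collections $\gamma=(\gamma_p)_{p\in\mathcal P}$ of vectors of $\mathbb C^n$ such that, for every $I\subseteq\mathcal P$, the family $(\gamma_p)_{p\in I}$ is linearly independent if and only if $I$ is independent in $M$. For a subspace $l$ let $\gamma_l$ be the span of the $\gamma_p$ with $p\in l$.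 A collection $\gamma$ indexed by the points of a matroid is quasi-stable if $\dim\bigcap_{l\in\mathcal L_p}\gamma_l=a_p$ for every point $p\notin P_M$ of that matroid, where the intersection is taken inside the span of $\gamma$ (so that it equals the span of $\gamma$ when $\mathcal L_p=\emptyset$). Let $\Gamma_M^0$ be the set of stable realizations of $M$: the $\gamma\in\Gamma_M$ such that for every $j\ge 0$ with $M^j\neq\emptyset$ the restriction $\gamma|_{M^j}$ is quasi-stable for the matroid $M^j$. **Theorem.** For every solvable matroid $M$, the space $\Gamma_M^0$ is either irreducible or empty, with respect to the Zariski topology on $(\mathbb C^n)^{\mathcal P}$. -/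

import Mathlib

namespace SolvableMatroid

noncomputable section

universe u

variable {α : Type u}

/-! ### Subspaces of a matroid -/

/-- The rank of a matroid, as a natural number. -/
def rank (M : Matroid α) : ℕ := M.eRank.toNat

/-- The circuits of size less than `n + 1`, where `n` is the rank of the matroid. -/
def smallCircuits (M : Matroid α) : Set (Set α) :=
  {C | M.IsCircuit C ∧ C.encard < M.eRank + 1}

/-- The subspaces of `M`: the equivalence classes of the circuits of size less than `n + 1` for the
relation "same closure". -/
def subspaces (M : Matroid α) : Set (Set (Set α)) :=
  {l | ∃ C ∈ smallCircuits M, l = {C' ∈ smallCircuits M | M.closure C' = M.closure C}}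

/-- The points of a subspace `l`: those that lie in some circuit of the class `l`. -/
def points (l : Set (Set α)) : Set α := {p | ∃ C ∈ l, p ∈ C}

/-- The rank of a subspace, i.e. the rank of its set of points. It is the common rank of
the circuits of the class, see `eRk_points_eq`. -/
def subspaceRank (M : Matroid α) (l : Set (Set α)) : ℕ := (M.eRk (points l)).toNat

/-- The set of subspaces that contain the point `p`. Its size is the degree of `p`. -/
def subspacesThrough (M : Matroid α) (p : α) : Set (Set (Set α)) :=
  {l ∈ subspaces M | p ∈ points l}

theorem eRk_points_eq (M : Matroid α) {l : Set (Set α)} (hl : l ∈ subspaces M)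
    {C : Set α} (hC : C ∈ l) : M.eRk (points l) = M.eRk C := by
  obtain ⟨C₀, -, rfl⟩ := hl
  refine le_antisymm ?_ (M.eRk_mono fun p hp => ⟨C, hC, hp⟩)
  rw [← M.eRk_closure_eq C, hC.2]
  refine M.eRk_mono ?_
  rintro p ⟨C', hC', hp⟩
  rw [← hC'.2]
  exact M.mem_closure_of_mem hp hC'.1.1.subset_ground

theorem finite_subspaces (M : Matroid α) [M.Finite] : (subspaces M).Finite := by
  have h : (smallCircuits M).Finite :=
    M.ground_finite.finite_subsets.subset fun C hC => hC.1.subset_ground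
  refine h.finite_subsets.subset ?_
  rintro l ⟨C, -, rfl⟩
  exact fun C' hC' => hC'.1

theorem finite_subspacesThrough (M : Matroid α) [M.Finite] (p : α) :
    (subspacesThrough M p).Finite :=
  (finite_subspaces M).subset fun _ h => h.1

/-! ### Solvable matroids -/

/-- The expected dimension `a_p = ∑ rank(l) - n (|L_p| - 1)`, the sum being over the set `L_p` of
the subspaces through `p`. -/
def expectedDim (M : Matroid α) (p : α) : ℤ :=
  (∑ᶠ l ∈ subspacesThrough M p, (subspaceRank M l : ℤ))
    - (rank M : ℤ) * (((subspacesThrough M p).ncard : ℤ) - 1)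

/-- The set `P_M` of the points `p` of `M` with `a_p ≤ 0`. -/
def criticalPoints (M : Matroid α) : Set α := {p ∈ M.E | expectedDim M p ≤ 0}

/-- The solvable chain: `M⁰ = M` and `M^(j+1)` is the submatroid of `M^j` on the set `P_(M^j)`. -/
def chain (M : Matroid α) : ℕ → Matroid α
  | 0 => M
  | j + 1 => (chain M j).restrict (criticalPoints (chain M j))

theorem chain_ground_subset (M : Matroid α) (j : ℕ) : (chain M j).E ⊆ M.E := by
  induction j with
  | zero => exact subset_rfl
  | succ j ih => exact fun p hp => ih hp.1

/-- `M` is solvable if its solvable chain reaches the empty matroid. -/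
def IsSolvable (M : Matroid α) : Prop := ∃ j, (chain M j).E = ∅

/-! ### Stable realizations -/

/-- The space of realizations of `M` in `ℂ^d`: the collections of vectors indexed by the points
of `M` that have exactly the same independent sets as `M`. -/
def realizations (M : Matroid α) (d : ℕ) : Set (M.E → Fin d → ℂ) :=
  {γ | ∀ I : Set M.E, LinearIndepOn ℂ γ I ↔ M.Indep (Subtype.val '' I)}

/-- The subspace `γ_l` spanned by the vectors of the points of `l`. -/
def spanOf {M : Matroid α} {d : ℕ} (γ : M.E → Fin d → ℂ) (l : Set (Set α)) :
    Submodule ℂ (Fin d → ℂ) :=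
  Submodule.span ℂ (γ '' {p | (p : α) ∈ points l})

/-- The intersection `V_{γ,p}` of the subspaces `γ_l` over all `l` through `p`, taken inside the
span of `γ`. (So it is the whole span of `γ` if no subspace passes through `p`; otherwise the
intersection with the span changes nothing.) -/
def meetAt {M : Matroid α} {d : ℕ} (γ : M.E → Fin d → ℂ) (p : α) :
    Submodule ℂ (Fin d → ℂ) :=
  Submodule.span ℂ (Set.range γ) ⊓ ⨅ l ∈ subspacesThrough M p, spanOf γ l

/-- `γ` is stable at `p` if the intersection of the `γ_l` over the subspaces `l` through `p` has
the expected dimension. -/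
def IsStableAt {M : Matroid α} {d : ℕ} (γ : M.E → Fin d → ℂ) (p : α) : Prop :=
  (Module.finrank ℂ (meetAt γ p) : ℤ) = expectedDim M p

/-- `γ` is quasi-stable if it is stable at every point outside `P_M`. -/
def IsQuasiStable {M : Matroid α} {d : ℕ} (γ : M.E → Fin d → ℂ) : Prop :=
  ∀ p ∈ M.E, p ∉ criticalPoints M → IsStableAt γ p

/-- The restriction of a collection of vectors to the submatroid `M^j`. -/
def restrictToChain {M : Matroid α} {d : ℕ} (γ : M.E → Fin d → ℂ) (j : ℕ) :
    (chain M j).E → Fin d → ℂ :=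
  fun p => γ ⟨p, chain_ground_subset M j p.2⟩

/-- The space `Γ⁰` of stable realizations of `M` in `ℂ^n`, `n` the rank of `M`: the
realizations whose restriction to every member of the solvable chain is quasi-stable.
(The condition is void for those `j` for which `M^j` is empty.) -/
def stableRealizations (M : Matroid α) : Set (M.E → Fin (rank M) → ℂ) :=
  {γ | γ ∈ realizations M (rank M) ∧ ∀ j : ℕ, IsQuasiStable (restrictToChain γ j)}

/-! ### The Zariski topology -/

/-- The common zero set of a set of polynomials in the coordinates `x_{i,j}` of collections of
vectors indexed by `ι`. -/
def zeroSet {ι κ : Type*} (S : Set (MvPolynomial (ι × κ) ℂ)) : Set (ι → κ → ℂ) :=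
  {γ | ∀ f ∈ S, MvPolynomial.eval (fun ij : ι × κ => γ ij.1 ij.2) f = 0}

/-- The Zariski topology on the affine space of collections of vectors: the closed sets are the
common zero sets of sets of polynomials. -/
abbrev zariskiTopology (ι κ : Type*) : TopologicalSpace (ι → κ → ℂ) :=
  TopologicalSpace.ofClosed {Z | ∃ S : Set (MvPolynomial (ι × κ) ℂ), Z = zeroSet S}
    ⟨{1}, by ext γ; simp [zeroSet]⟩
    (by
      intro A hA
      refine ⟨{f | ∃ S, zeroSet S ∈ A ∧ f ∈ S}, ?_⟩
      ext γ
      constructor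
      · rintro h f ⟨S, hS, hf⟩
        exact h _ hS f hf
      · intro h Z hZ
        obtain ⟨S, rfl⟩ := hA hZ
        exact fun f hf => h f ⟨S, hZ, hf⟩)
    (by
      rintro _ ⟨S, rfl⟩ _ ⟨T, rfl⟩
      refine ⟨{h | ∃ f ∈ S, ∃ g ∈ T, h = f * g}, ?_⟩
      ext γ
      constructor
      · rintro (h | h) _ ⟨f, hf, g, hg, rfl⟩
        · simp [h f hf]
        · simp [h g hg]
      · intro h
        by_contra hc
        simp only [Set.mem_union, not_or, zeroSet, Set.mem_ofPred_eq, not_forall] at hc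
        obtain ⟨⟨f, hf, hf0⟩, g, hg, hg0⟩ := hc
        have := h _ ⟨f, hf, g, hg, rfl⟩
        rw [map_mul] at this
        exact (mul_ne_zero hf0 hg0) this)

end

end SolvableMatroid

/-! Any two stable realizations `x`, `y` are joined by a rational curve `γ` with `γ 0 = x`, `γ 1 =
y` and `γ t` stable for all but finitely many `t`. This gives irreducibility: if polynomials `f`,
`g` satisfy `f x ≠ 0` and `g y ≠ 0`, then `f (γ t)` and `g (γ t)` are nonzero rational functions of
`t`, so some stable `γ t` lies in both basic open sets.

The curve is built by induction along the solvable chain (`exists_stable_curve`): a curve for the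
submatroid on `P_M` is extended to `M` by `exists_quasiStable_extension`. The extension first moves
a basis of each subspace `l`, keeping its points in `P_M` on the given curve. A point `p` outside
`P_M` must then move inside the intersection of the moving spans. That intersection is the kernel of
a matrix depending rationally on `t`. Counting equations shows that its dimension is at least `a_p`,
and quasi-stability says that it equals `a_p` at `t = 0` and `t = 1`. Since rank can only drop on a
proper closed set, the dimension is `a_p` for almost all `t`, and prescribed kernel vectors at the
two ends can be joined rationally (`exists_regular_curve_in_ker`). Finally, `realizesOn_of_mem`
shows that the resulting points again realize `M`: independence is an open condition, and lying in
spans of the correct dimension forces the dependencies.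

The points `0` and `1` are part of `endsFilter` because the values there are prescribed and must
survive every construction. -/

namespace SolvableMatroid

open Filter Module
open scoped Matrix

/-! ### Rational curves through two prescribed points -/

/-- The filter of the cofinite sets of complex numbers that contain `0` and `1`. -/
def endsFilter : Filter ℂ := cofinite ⊔ (pure 0 ⊔ pure 1)

theorem eventually_endsFilter {q : ℂ → Prop} :
    (∀ᶠ t in endsFilter, q t) ↔ (∀ᶠ t in cofinite, q t) ∧ q 0 ∧ q 1 := by
  simp [endsFilter]

theorem eventually_eval_ne_zero {a : Polynomial ℂ} (ha : a ≠ 0) :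
    ∀ᶠ t in cofinite, a.eval t ≠ 0 := by
  refine (a.roots.toFinset.finite_toSet).subset fun t ht => ?_
  simpa [ha] using ht

/-- A function is regular if it agrees, at `0`, at `1` and at almost all points, with a rational
function without pole there. -/
def IsReg (c : ℂ → ℂ) : Prop :=
  ∃ a b : Polynomial ℂ, ∀ᶠ t in endsFilter, b.eval t ≠ 0 ∧ c t * b.eval t = a.eval t

namespace IsReg

theorem const (z : ℂ) : IsReg fun _ => z :=
  ⟨Polynomial.C z, 1, by simp⟩

theorem id : IsReg fun t => t :=
  ⟨Polynomial.X, 1, by simp⟩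

theorem add {c e : ℂ → ℂ} (hc : IsReg c) (he : IsReg e) : IsReg fun t => c t + e t := by
  obtain ⟨a, b, h⟩ := hc
  obtain ⟨a', b', h'⟩ := he
  refine ⟨a * b' + a' * b, b * b', ?_⟩
  filter_upwards [h, h'] with t ht ht'
  refine ⟨by simpa using ⟨ht.1, ht'.1⟩, ?_⟩
  simp only [Polynomial.eval_add, Polynomial.eval_mul, ← ht.2, ← ht'.2]
  ring

theorem mul {c e : ℂ → ℂ} (hc : IsReg c) (he : IsReg e) : IsReg fun t => c t * e t := by
  obtain ⟨a, b, h⟩ := hc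
  obtain ⟨a', b', h'⟩ := he
  refine ⟨a * a', b * b', ?_⟩
  filter_upwards [h, h'] with t ht ht'
  refine ⟨by simpa using ⟨ht.1, ht'.1⟩, ?_⟩
  simp only [Polynomial.eval_mul, ← ht.2, ← ht'.2]
  ring

theorem neg {c : ℂ → ℂ} (hc : IsReg c) : IsReg fun t => -c t := by
  simpa using (const (-1)).mul hc

theorem sub {c e : ℂ → ℂ} (hc : IsReg c) (he : IsReg e) : IsReg fun t => c t - e t := by
  simpa [sub_eq_add_neg] using hc.add he.neg

theorem sum {ι : Type*} (s : Finset ι) {c : ι → ℂ → ℂ} (h : ∀ i ∈ s, IsReg (c i)) :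
    IsReg fun t => ∑ i ∈ s, c i t := by
  classical
  induction s using Finset.induction_on with
  | empty => simpa using const 0
  | insert i s hi ih =>
    simp only [Finset.sum_insert hi]
    exact (h i (by simp)).add (ih fun j hj => h j (by simp [hj]))

theorem prod {ι : Type*} (s : Finset ι) {c : ι → ℂ → ℂ} (h : ∀ i ∈ s, IsReg (c i)) :
    IsReg fun t => ∏ i ∈ s, c i t := by
  classical
  induction s using Finset.induction_on with
  | empty => simpa using const 1
  | insert i s hi ih =>
    simp only [Finset.prod_insert hi]
    exact (h i (by simp)).mul (ih fun j hj => h j (by simp [hj]))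

theorem lerp (z w : ℂ) : IsReg fun t => (1 - t) * z + t * w :=
  (((const 1).sub id).mul (const z)).add (id.mul (const w))

/-- A nonzero value at one end makes the numerator a nonzero polynomial, which has finitely many
roots. -/
theorem eventually_ne {c : ℂ → ℂ} (hc : IsReg c) (h : c 0 ≠ 0 ∨ c 1 ≠ 0) :
    ∀ᶠ t in cofinite, c t ≠ 0 := by
  obtain ⟨a, b, hab⟩ := hc
  obtain ⟨hco, h0, h1⟩ := eventually_endsFilter.1 hab
  have ha : a ≠ 0 := by
    rintro rfl
    rcases h with h | h
    · exact mul_ne_zero h h0.1 (by simpa using h0.2)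
    · exact mul_ne_zero h h1.1 (by simpa using h1.2)
  filter_upwards [hco, eventually_eval_ne_zero ha] with t ht ht' h
  rw [h, zero_mul] at ht
  exact ht' ht.2.symm

theorem eventually_ne_ends {c : ℂ → ℂ} (hc : IsReg c) (h0 : c 0 ≠ 0) (h1 : c 1 ≠ 0) :
    ∀ᶠ t in endsFilter, c t ≠ 0 :=
  eventually_endsFilter.2 ⟨hc.eventually_ne (Or.inl h0), h0, h1⟩

theorem inv {c : ℂ → ℂ} (hc : IsReg c) (h0 : c 0 ≠ 0) (h1 : c 1 ≠ 0) :
    IsReg fun t => (c t)⁻¹ := by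
  have hne := hc.eventually_ne_ends h0 h1
  obtain ⟨a, b, hab⟩ := hc
  refine ⟨b, a, ?_⟩
  filter_upwards [hab, hne] with t ht hc
  rw [← ht.2]
  exact ⟨mul_ne_zero hc ht.1, inv_mul_cancel_left₀ hc _⟩

theorem mulVec {m n : Type*} [Fintype n] {A : ℂ → Matrix m n ℂ} {v : ℂ → n → ℂ}
    (hA : ∀ i j, IsReg fun t => A t i j) (hv : ∀ j, IsReg fun t => v t j) (i : m) :
    IsReg fun t => (A t *ᵥ v t) i := by
  simp only [Matrix.mulVec, dotProduct]
  exact sum _ fun j _ => (hA i j).mul (hv j)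

theorem matrix_mul {l m n : Type*} [Fintype m] {A : ℂ → Matrix l m ℂ} {B : ℂ → Matrix m n ℂ}
    (hA : ∀ i j, IsReg fun t => A t i j) (hB : ∀ i j, IsReg fun t => B t i j) (i : l) (j : n) :
    IsReg fun t => (A t * B t) i j := by
  simp only [Matrix.mul_apply]
  exact sum _ fun k _ => (hA i k).mul (hB k j)

theorem det {n : Type*} [Fintype n] [DecidableEq n] {A : ℂ → Matrix n n ℂ}
    (hA : ∀ i j, IsReg fun t => A t i j) : IsReg fun t => (A t).det := by
  simp only [Matrix.det_apply']
  exact sum _ fun σ _ => (const _).mul (prod _ fun i _ => hA _ _)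

theorem matrix_inv {n : Type*} [Fintype n] [DecidableEq n] {A : ℂ → Matrix n n ℂ}
    (hA : ∀ i j, IsReg fun t => A t i j) (h0 : (A 0).det ≠ 0) (h1 : (A 1).det ≠ 0) (i j : n) :
    IsReg fun t => (A t)⁻¹ i j := by
  simp only [Matrix.inv_def, Ring.inverse_eq_inv', Matrix.smul_apply, smul_eq_mul,
    Matrix.adjugate_apply]
  refine ((det hA).inv h0 h1).mul (det fun k l => ?_)
  simp only [Matrix.updateRow_apply]
  split_ifs
  · exact const _
  · exact hA k l

theorem eval {σ : Type*} (f : MvPolynomial σ ℂ) {v : ℂ → σ → ℂ}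
    (hv : ∀ i, IsReg fun t => v t i) : IsReg fun t => MvPolynomial.eval (v t) f := by
  induction f using MvPolynomial.induction_on with
  | C z => simpa using const z
  | add f g hf hg => simpa using hf.add hg
  | mul_X f i hf => simpa using hf.mul (hv i)

end IsReg

/-! ### Kernels of curves of matrices of constant rank -/

/-- Here `r` is the rank of `A`: `B` comes from a section of `A` onto its range and `P` from a
projection to the range, both in coordinates on the range. The identity certifies rank at least `r`
and persists generically as a nonvanishing determinant. -/
theorem exists_mul_mul_eq_one {m n : Type*} [Fintype m] [Fintype n] [DecidableEq m]
    [DecidableEq n] (A : Matrix m n ℂ) (r : ℕ)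
    (hr : finrank ℂ (LinearMap.ker A.mulVecLin) + r = Fintype.card n) :
    ∃ (P : Matrix (Fin r) m ℂ) (B : Matrix n (Fin r) ℂ), P * A * B = 1 := by
  have hrk : finrank ℂ (LinearMap.range A.mulVecLin) = finrank ℂ (Fin r → ℂ) := by
    have := A.mulVecLin.finrank_range_add_finrank_ker
    simp only [finrank_fintype_fun_eq_card, Fintype.card_fin] at this ⊢
    omega
  let e := LinearEquiv.ofFinrankEq _ _ hrk
  obtain ⟨p, hp⟩ := (LinearMap.range A.mulVecLin).subtype.exists_leftInverse_of_injective
    (Submodule.ker_subtype _)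
  obtain ⟨b, hb⟩ := A.mulVecLin.rangeRestrict.exists_rightInverse_of_surjective
    (LinearMap.range_rangeRestrict _)
  refine ⟨LinearMap.toMatrix' (e.toLinearMap ∘ₗ p), LinearMap.toMatrix' (b ∘ₗ e.symm.toLinearMap),
    ?_⟩
  apply Matrix.toLin'.injective
  rw [Matrix.toLin'_mul, Matrix.toLin'_mul, Matrix.toLin'_toMatrix', Matrix.toLin'_toMatrix',
    Matrix.toLin'_one, Matrix.toLin'_apply']
  refine LinearMap.ext fun z => ?_
  have h1 := LinearMap.congr_fun hb (e.symm z)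
  have h2 := LinearMap.congr_fun hp (e.symm z)
  have h3 : A.mulVecLin (b (e.symm z)) = (e.symm z : m → ℂ) := congrArg Subtype.val h1
  simp only [LinearMap.comp_apply, LinearEquiv.coe_coe, LinearMap.id_apply,
    Submodule.subtype_apply] at h2 ⊢
  rw [h3, h2, e.apply_symm_apply]

/-- A curve of matrices whose kernels have the same dimension `k` at `0` and `1`, and at least
that dimension elsewhere, has kernels of dimension `k` almost everywhere, and vectors of the
kernels at `0` and `1` are joined by a regular curve in the kernels. -/
theorem exists_regular_curve_in_ker {m n : Type*} [Fintype m] [Fintype n]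
    {A : ℂ → Matrix m n ℂ} (hA : ∀ i j, IsReg fun t => A t i j) {k : ℕ}
    (h0 : finrank ℂ (LinearMap.ker (A 0).mulVecLin) = k)
    (h1 : finrank ℂ (LinearMap.ker (A 1).mulVecLin) = k)
    (hk : ∀ᶠ t in endsFilter, k ≤ finrank ℂ (LinearMap.ker (A t).mulVecLin)) :
    (∀ᶠ t in endsFilter, finrank ℂ (LinearMap.ker (A t).mulVecLin) = k) ∧
      ∀ v₀ v₁ : n → ℂ, A 0 *ᵥ v₀ = 0 → A 1 *ᵥ v₁ = 0 → ∃ v : ℂ → n → ℂ,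
        (∀ j, IsReg fun t => v t j) ∧ v 0 = v₀ ∧ v 1 = v₁ ∧
          ∀ᶠ t in endsFilter, A t *ᵥ v t = 0 := by
  classical
  have hkn : k ≤ Fintype.card n := by
    rw [← h0, ← finrank_fintype_fun_eq_card ℂ (η := n)]
    exact Submodule.finrank_le _
  obtain ⟨r, hr⟩ := Nat.exists_eq_add_of_le hkn
  obtain ⟨P₀, B₀, hPB₀⟩ := exists_mul_mul_eq_one (A 0) r (by omega)
  obtain ⟨P₁, B₁, hPB₁⟩ := exists_mul_mul_eq_one (A 1) r (by omega)
  -- The certificates of rank `r` at the two ends are interpolated linearly, so `P t * A t * B t` is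
  -- the identity at `0` and `1`, hence invertible almost everywhere.
  let P : ℂ → Matrix (Fin r) m ℂ := fun t => Matrix.of fun i j => (1 - t) * P₀ i j + t * P₁ i j
  let B : ℂ → Matrix n (Fin r) ℂ := fun t => Matrix.of fun i j => (1 - t) * B₀ i j + t * B₁ i j
  have hP : ∀ i j, IsReg fun t => P t i j := fun i j => IsReg.lerp _ _
  have hB : ∀ i j, IsReg fun t => B t i j := fun i j => IsReg.lerp _ _
  have P0 : P 0 = P₀ := by ext; simp [P]
  have P1 : P 1 = P₁ := by ext; simp [P]
  have B0 : B 0 = B₀ := by ext; simp [B]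
  have B1 : B 1 = B₁ := by ext; simp [B]
  have hPA := IsReg.matrix_mul hP hA
  have hG := IsReg.matrix_mul hPA hB
  have hG0 : (P 0 * A 0 * B 0).det ≠ 0 := by simp [P0, B0, hPB₀]
  have hG1 : (P 1 * A 1 * B 1).det ≠ 0 := by simp [P1, B1, hPB₁]
  have hdet := (IsReg.det hG).eventually_ne_ends hG0 hG1
  have hker : ∀ᶠ t in endsFilter, finrank ℂ (LinearMap.ker (A t).mulVecLin) = k ∧
      LinearMap.ker (A t).mulVecLin = LinearMap.ker (P t * A t).mulVecLin := by
    filter_upwards [hdet, hk] with t ht hkt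
    have hle : LinearMap.ker (A t).mulVecLin ≤ LinearMap.ker (P t * A t).mulVecLin := by
      intro v hv
      simp only [LinearMap.mem_ker, Matrix.mulVecLin_apply] at hv ⊢
      rw [← Matrix.mulVec_mulVec, hv, Matrix.mulVec_zero]
    have hsurj : LinearMap.range (P t * A t).mulVecLin = ⊤ := by
      refine LinearMap.range_eq_top.2 fun z => ⟨B t *ᵥ ((P t * A t * B t)⁻¹ *ᵥ z), ?_⟩
      rw [Matrix.mulVecLin_apply, Matrix.mulVec_mulVec, Matrix.mulVec_mulVec,
        Matrix.mul_nonsing_inv _ (isUnit_iff_ne_zero.2 ht), Matrix.one_mulVec]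
    have hdim : finrank ℂ (LinearMap.ker (P t * A t).mulVecLin) = k := by
      have := (P t * A t).mulVecLin.finrank_range_add_finrank_ker
      rw [hsurj, finrank_top] at this
      simp only [finrank_fintype_fun_eq_card, Fintype.card_fin] at this
      omega
    -- The kernel of `P t * A t` has dimension exactly `k`, and the assumed lower bound makes the
    -- smaller kernel of `A t` fill it.
    have heq := Submodule.eq_of_le_of_finrank_le hle (hdim.trans_le hkt)
    exact ⟨heq ▸ hdim, heq⟩
  refine ⟨hker.mono fun t ht => ht.1, fun v₀ v₁ hv₀ hv₁ => ?_⟩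
  let u : ℂ → n → ℂ := fun t j => (1 - t) * v₀ j + t * v₁ j
  have hu : ∀ j, IsReg fun t => u t j := fun j => IsReg.lerp _ _
  have u0 : u 0 = v₀ := by ext; simp [u]
  have u1 : u 1 = v₁ := by ext; simp [u]
  -- This projects `u t` to the kernel of `P t * A t` along the range of `B t`. At the ends `u` is
  -- already in the kernel, so the correction vanishes.
  refine ⟨fun t => u t - B t *ᵥ ((P t * A t * B t)⁻¹ *ᵥ ((P t * A t) *ᵥ u t)), fun j => ?_, ?_, ?_,
    ?_⟩
  · exact (hu j).sub (IsReg.mulVec hB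
      (IsReg.mulVec (IsReg.matrix_inv hG hG0 hG1) (IsReg.mulVec hPA hu)) j)
  · simp only [u0, ← Matrix.mulVec_mulVec, hv₀, Matrix.mulVec_zero, sub_zero]
  · simp only [u1, ← Matrix.mulVec_mulVec, hv₁, Matrix.mulVec_zero, sub_zero]
  · filter_upwards [hker, hdet] with t ht hdt
    rw [← Matrix.mulVecLin_apply, ← LinearMap.mem_ker, ht.2, LinearMap.mem_ker,
      Matrix.mulVecLin_apply, Matrix.mulVec_sub, sub_eq_zero, Matrix.mulVec_mulVec,
      Matrix.mulVec_mulVec, Matrix.mul_nonsing_inv _ (isUnit_iff_ne_zero.2 hdt),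
      Matrix.one_mulVec]

/-- Linear independence at `0` and `1` implies linear independence almost everywhere. -/
theorem eventually_linearIndependent {ι κ : Type*} [Finite ι] [Finite κ] {v : ℂ → ι → κ → ℂ}
    (hv : ∀ i j, IsReg fun t => v t i j) (h0 : LinearIndependent ℂ (v 0))
    (h1 : LinearIndependent ℂ (v 1)) : ∀ᶠ t in endsFilter, LinearIndependent ℂ (v t) := by
  have := Fintype.ofFinite ι
  have := Fintype.ofFinite κ
  have key : ∀ t, LinearIndependent ℂ (v t) ↔
      finrank ℂ (LinearMap.ker (Matrix.of (v t))ᵀ.mulVecLin) = 0 := by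
    intro t
    rw [Submodule.finrank_eq_zero, LinearMap.ker_eq_bot, Matrix.coe_mulVecLin,
      Matrix.mulVec_injective_iff]
    rfl
  simp only [key] at h0 h1 ⊢
  -- With `k = 0` the lower bound on the kernel dimension is free.
  exact (exists_regular_curve_in_ker (A := fun t => (Matrix.of (v t))ᵀ) (fun i j => hv j i) h0 h1
    (Eventually.of_forall fun t => Nat.zero_le _)).1

theorem eventually_linearIndepOn {α κ : Type*} [Finite κ] {v : ℂ → α → κ → ℂ} {s : Set α}
    (hs : s.Finite) (hv : ∀ i ∈ s, ∀ j, IsReg fun t => v t i j) (h0 : LinearIndepOn ℂ (v 0) s)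
    (h1 : LinearIndepOn ℂ (v 1) s) : ∀ᶠ t in endsFilter, LinearIndepOn ℂ (v t) s := by
  have := hs.to_subtype
  exact eventually_linearIndependent (v := fun t (i : s) => v t i) (fun i => hv i i.2) h0 h1

/-- Vectors in the spans of a regular family at `0` and `1` are joined by a regular curve in the
spans. -/
theorem exists_regular_curve_in_span {α κ : Type*} {β : ℂ → α → κ → ℂ} {s : Set α}
    (hβ : ∀ i ∈ s, ∀ j, IsReg fun t => β t i j) {v₀ v₁ : κ → ℂ}
    (h0 : v₀ ∈ Submodule.span ℂ (β 0 '' s)) (h1 : v₁ ∈ Submodule.span ℂ (β 1 '' s)) :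
    ∃ v : ℂ → κ → ℂ, (∀ j, IsReg fun t => v t j) ∧ v 0 = v₀ ∧ v 1 = v₁ ∧
      ∀ t, v t ∈ Submodule.span ℂ (β t '' s) := by
  rw [Finsupp.mem_span_image_iff_linearCombination] at h0 h1
  obtain ⟨c, hc, rfl⟩ := h0
  obtain ⟨e, he, rfl⟩ := h1
  rw [Finsupp.mem_supported] at hc he
  -- Coefficients at the two ends are weighted by `1 - t` and `t`, while the vectors follow `β t`.
  refine ⟨fun t => ∑ i ∈ c.support, ((1 - t) * c i) • β t i + ∑ i ∈ e.support, (t * e i) • β t i,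
    fun j => ?_, by simp [Finsupp.linearCombination_apply, Finsupp.sum],
    by simp [Finsupp.linearCombination_apply, Finsupp.sum], fun t => ?_⟩
  · simp only [Pi.add_apply, Finset.sum_apply, Pi.smul_apply, smul_eq_mul]
    exact (IsReg.sum _ fun i hi => (((IsReg.const 1).sub IsReg.id).mul (IsReg.const _)).mul
      (hβ i (hc hi) j)).add
      (IsReg.sum _ fun i hi => (IsReg.id.mul (IsReg.const _)).mul (hβ i (he hi) j))
  · exact add_mem
      (sum_mem fun i hi => Submodule.smul_mem _ _ (Submodule.subset_span ⟨i, hc hi, rfl⟩))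
      (sum_mem fun i hi => Submodule.smul_mem _ _ (Submodule.subset_span ⟨i, he hi, rfl⟩))

/-! ### Intersections of spans as kernels -/

/-- The matrix whose kernel is isomorphic to the intersection of the spans of the families `β` and
`δ i`, if these families are linearly independent. -/
def meetMatrix {B ι : Type*} [DecidableEq ι] {K : ι → Type*} {d : ℕ} (β : B → Fin d → ℂ)
    (δ : ∀ i, K i → Fin d → ℂ) : Matrix (ι × Fin d) (B ⊕ Σ i, K i) ℂ :=
  Matrix.of fun ij => Sum.elim (fun b => β b ij.2)
    fun q => if q.1 = ij.1 then -δ q.1 q.2 ij.2 else 0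

/-- The common vector of the spans described by an element of the kernel of `meetMatrix`. -/
def meetMap {B ι : Type*} [Fintype B] {d : ℕ} (K : ι → Type*) (β : B → Fin d → ℂ) :
    (B ⊕ (Σ i, K i) → ℂ) →ₗ[ℂ] (Fin d → ℂ) :=
  Fintype.linearCombination ℂ β ∘ₗ LinearMap.funLeft ℂ ℂ Sum.inl

theorem meetMap_apply {B ι : Type*} [Fintype B] {K : ι → Type*} {d : ℕ} {β : B → Fin d → ℂ}
    (w : B ⊕ (Σ i, K i) → ℂ) :
    meetMap K β w = ∑ b, w (Sum.inl b) • β b := rfl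

section meetMatrix

variable {B ι : Type*} [Fintype B] [Fintype ι] [DecidableEq ι] {K : ι → Type*}
  [∀ i, Fintype (K i)] {d : ℕ} {β : B → Fin d → ℂ} {δ : ∀ i, K i → Fin d → ℂ}

theorem meetMatrix_mulVec (w : B ⊕ (Σ i, K i) → ℂ) (i : ι) (j : Fin d) :
    (meetMatrix β δ *ᵥ w) (i, j) =
      (∑ b, w (Sum.inl b) • β b - ∑ q, w (Sum.inr ⟨i, q⟩) • δ i q) j := by
  have h : ∑ x : (Σ i, K i), meetMatrix β δ (i, j) (Sum.inr x) * w (Sum.inr x)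
      = ∑ q, -δ i q j * w (Sum.inr ⟨i, q⟩) := by
    rw [Fintype.sum_sigma, Finset.sum_eq_single i]
    · simp [meetMatrix]
    · intro i' _ hi'
      simp [meetMatrix, hi']
    · simp
  simp only [Matrix.mulVec, dotProduct, Fintype.sum_sum_type, h]
  simp [meetMatrix, sub_eq_add_neg, mul_comm]

theorem mem_ker_meetMatrix {w : B ⊕ (Σ i, K i) → ℂ} :
    meetMatrix β δ *ᵥ w = 0 ↔
      ∀ i, ∑ b, w (Sum.inl b) • β b = ∑ q, w (Sum.inr ⟨i, q⟩) • δ i q := by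
  simp only [funext_iff, Prod.forall, meetMatrix_mulVec, Pi.zero_apply, Pi.sub_apply, sub_eq_zero]

theorem map_ker_meetMatrix :
    (LinearMap.ker (meetMatrix β δ).mulVecLin).map (meetMap K β) =
      Submodule.span ℂ (Set.range β) ⊓ ⨅ i, Submodule.span ℂ (Set.range (δ i)) := by
  ext v
  simp only [Submodule.mem_map, LinearMap.mem_ker, Matrix.mulVecLin_apply, mem_ker_meetMatrix,
    meetMap_apply, Submodule.mem_inf, Submodule.mem_iInf, Submodule.mem_span_range_iff_exists_fun]
  constructor
  · rintro ⟨w, hw, rfl⟩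
    exact ⟨⟨_, rfl⟩, fun i => ⟨_, (hw i).symm⟩⟩
  · rintro ⟨⟨c, rfl⟩, h⟩
    choose e he using h
    exact ⟨Sum.elim c fun q => e q.1 q.2, fun i => (he i).symm, rfl⟩

/-- A kernel vector is a common vector together with its coordinates in every family; independence
makes these coordinates unique, so `meetMap` is injective on the kernel. -/
theorem finrank_ker_meetMatrix (hβ : LinearIndependent ℂ β)
    (hδ : ∀ i, LinearIndependent ℂ (δ i)) :
    finrank ℂ (LinearMap.ker (meetMatrix β δ).mulVecLin) =
      finrank ℂ (Submodule.span ℂ (Set.range β) ⊓ ⨅ i, Submodule.span ℂ (Set.range (δ i)) :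
        Submodule ℂ (Fin d → ℂ)) := by
  rw [← map_ker_meetMatrix, ← LinearMap.range_domRestrict]
  refine (LinearMap.finrank_range_of_inj ?_).symm
  rw [← LinearMap.ker_eq_bot, LinearMap.ker_eq_bot']
  rintro ⟨w, hw⟩ h
  rw [LinearMap.mem_ker, Matrix.mulVecLin_apply, mem_ker_meetMatrix] at hw
  rw [LinearMap.domRestrict_apply, meetMap_apply] at h
  ext x
  rcases x with b | ⟨i, q⟩
  · exact Fintype.linearIndependent_iff.1 hβ _ h b
  · exact Fintype.linearIndependent_iff.1 (hδ i) _ ((hw i).symm.trans h) q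

/-- Each block of equations takes values in the span of `β`, of dimension at most `|B|`, rather than
in all of `ℂ^d`. This saving gives the expected dimension also for members of the chain whose rank
is less than `d`. -/
theorem le_finrank_ker_meetMatrix
    (hsub : ∀ i q, δ i q ∈ Submodule.span ℂ (Set.range β)) :
    Fintype.card B + ∑ i, Fintype.card (K i) ≤
      finrank ℂ (LinearMap.ker (meetMatrix β δ).mulVecLin) + Fintype.card ι * Fintype.card B := by
  let W := Submodule.span ℂ (Set.range β)
  let g : (ι → W) →ₗ[ℂ] (ι × Fin d → ℂ) :=
    { toFun := fun u ij => (u ij.1 : Fin d → ℂ) ij.2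
      map_add' := fun _ _ => rfl
      map_smul' := fun _ _ => rfl }
  have hle : LinearMap.range (meetMatrix β δ).mulVecLin ≤ LinearMap.range g := by
    rintro _ ⟨w, rfl⟩
    refine ⟨fun i => ⟨∑ b, w (Sum.inl b) • β b - ∑ q, w (Sum.inr ⟨i, q⟩) • δ i q, ?_⟩, ?_⟩
    · exact sub_mem
        (sum_mem fun b _ => Submodule.smul_mem _ _ (Submodule.subset_span ⟨b, rfl⟩))
        (sum_mem fun q _ => Submodule.smul_mem _ _ (hsub i q))
    · ext ⟨i, j⟩
      exact (meetMatrix_mulVec w i j).symm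
  have h1 := (Submodule.finrank_mono hle).trans (LinearMap.finrank_range_le g)
  rw [Module.finrank_pi_fintype, Finset.sum_const, Finset.card_univ, smul_eq_mul] at h1
  have h2 : finrank ℂ W ≤ Fintype.card B := finrank_range_le_card β
  have h3 := (meetMatrix β δ).mulVecLin.finrank_range_add_finrank_ker
  rw [finrank_fintype_fun_eq_card, Fintype.card_sum, Fintype.card_sigma] at h3
  have h4 := Nat.mul_le_mul_left (Fintype.card ι) h2
  omega

end meetMatrix

/-- If the intersection of the spans of regular families has the expected dimension `a` at `0` and
`1`, then it has the expected dimension almost everywhere, and vectors of the intersections at `0`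
and `1` are joined by a regular curve in the intersections. -/
theorem exists_regular_curve_in_meet {B ι : Type*} [Fintype B] [Fintype ι] {K : ι → Type*}
    [∀ i, Fintype (K i)] {d : ℕ} {β : ℂ → B → Fin d → ℂ} {δ : ℂ → ∀ i, K i → Fin d → ℂ}
    (rβ : ∀ b j, IsReg fun t => β t b j) (rδ : ∀ i q j, IsReg fun t => δ t i q j)
    (hβ : ∀ᶠ t in endsFilter, LinearIndependent ℂ (β t))
    (hδ : ∀ᶠ t in endsFilter, ∀ i, LinearIndependent ℂ (δ t i))
    (hsub : ∀ᶠ t in endsFilter, ∀ i q, δ t i q ∈ Submodule.span ℂ (Set.range (β t)))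
    {V : ℂ → Submodule ℂ (Fin d → ℂ)}
    (hV : ∀ t, V t = Submodule.span ℂ (Set.range (β t)) ⊓
      ⨅ i, Submodule.span ℂ (Set.range (δ t i)))
    {a : ℤ} (ha : a = ∑ i, (Fintype.card (K i) : ℤ) -
      Fintype.card B * ((Fintype.card ι : ℤ) - 1))
    (h0 : (finrank ℂ (V 0) : ℤ) = a) (h1 : (finrank ℂ (V 1) : ℤ) = a) :
    (∀ᶠ t in endsFilter, (finrank ℂ (V t) : ℤ) = a) ∧
      ∀ v₀ ∈ V 0, ∀ v₁ ∈ V 1, ∃ v : ℂ → Fin d → ℂ,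
        (∀ j, IsReg fun t => v t j) ∧ v 0 = v₀ ∧ v 1 = v₁ ∧ ∀ᶠ t in endsFilter, v t ∈ V t := by
  classical
  have hkV : ∀ᶠ t in endsFilter,
      finrank ℂ (LinearMap.ker (meetMatrix (β t) (δ t)).mulVecLin) = finrank ℂ (V t) := by
    filter_upwards [hβ, hδ] with t h h'
    rw [hV, finrank_ker_meetMatrix h h']
  obtain ⟨-, hk0, hk1⟩ := eventually_endsFilter.1 hkV
  have hreg : ∀ i j, IsReg fun t => meetMatrix (β t) (δ t) i j := by
    rintro ⟨i, j⟩ (b | ⟨i', q⟩)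
    · exact rβ b j
    · simp only [meetMatrix, Matrix.of_apply, Sum.elim_inr]
      split_ifs
      · exact (rδ i' q j).neg
      · exact IsReg.const 0
  obtain ⟨hk, hv⟩ := exists_regular_curve_in_ker hreg hk0 (k := finrank ℂ (V 0))
    (hk1.trans (by omega)) <| by
      filter_upwards [hsub] with t ht
      have := le_finrank_ker_meetMatrix ht
      zify at this ⊢
      rw [h0, ha]
      linarith
  refine ⟨?_, fun v₀ hv₀ v₁ hv₁ => ?_⟩
  · filter_upwards [hk, hkV] with t h h'
    rw [← h', h, h0]
  · rw [hV, ← map_ker_meetMatrix] at hv₀ hv₁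
    obtain ⟨w₀, hw₀, rfl⟩ := hv₀
    obtain ⟨w₁, hw₁, rfl⟩ := hv₁
    obtain ⟨w, rw, rfl, rfl, hw⟩ := hv w₀ w₁ hw₀ hw₁
    refine ⟨fun t => meetMap K (β t) (w t), fun j => ?_, rfl, rfl, ?_⟩
    · simp only [meetMap_apply, Finset.sum_apply, Pi.smul_apply, smul_eq_mul]
      exact IsReg.sum _ fun b _ => (rw _).mul (rβ b j)
    · filter_upwards [hw] with t ht
      rw [hV, ← map_ker_meetMatrix]
      exact ⟨w t, ht, rfl⟩

theorem exists_regular_curve_in_meet_image {α ι : Type*} {d : ℕ} {B : Set α} (hB : B.Finite)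
    {L : Set ι} [Fintype L] {D : ι → Set α} (hD : ∀ l ∈ L, (D l).Finite)
    {β τ : ℂ → α → Fin d → ℂ} (rβ : ∀ b ∈ B, ∀ j, IsReg fun t => β t b j)
    (rτ : ∀ l ∈ L, ∀ q ∈ D l, ∀ j, IsReg fun t => τ t q j)
    (hβ : ∀ᶠ t in endsFilter, LinearIndepOn ℂ (β t) B)
    (hτ : ∀ᶠ t in endsFilter, ∀ l ∈ L, LinearIndepOn ℂ (τ t) (D l))
    (hsub : ∀ᶠ t in endsFilter, ∀ l ∈ L, ∀ q ∈ D l, τ t q ∈ Submodule.span ℂ (β t '' B))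
    {V : ℂ → Submodule ℂ (Fin d → ℂ)}
    (hV : ∀ t, V t = Submodule.span ℂ (β t '' B) ⊓ ⨅ l ∈ L, Submodule.span ℂ (τ t '' D l))
    {a : ℤ} (ha : a = ∑ l : L, ((D l).ncard : ℤ) - B.ncard * ((Fintype.card L : ℤ) - 1))
    (h0 : (finrank ℂ (V 0) : ℤ) = a) (h1 : (finrank ℂ (V 1) : ℤ) = a) :
    (∀ᶠ t in endsFilter, (finrank ℂ (V t) : ℤ) = a) ∧
      ∀ v₀ ∈ V 0, ∀ v₁ ∈ V 1, ∃ v : ℂ → Fin d → ℂ,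
        (∀ j, IsReg fun t => v t j) ∧ v 0 = v₀ ∧ v 1 = v₁ ∧ ∀ᶠ t in endsFilter, v t ∈ V t := by
  have := hB.fintype
  have hfin : ∀ l : L, Fintype (D l) := fun l => (hD l l.2).fintype
  have rβ' : ∀ (b : B) j, IsReg fun t => β t b j := fun b j => rβ b b.2 j
  have rτ' : ∀ (l : L) (q : D l) j, IsReg fun t => τ t q j := fun l q j => rτ l l.2 q q.2 j
  have hβ' : ∀ᶠ t in endsFilter, LinearIndependent ℂ fun b : B => β t b := hβ
  have hτ' : ∀ᶠ t in endsFilter, ∀ l : L, LinearIndependent ℂ fun q : D l => τ t q :=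
    hτ.mono fun t ht l => ht l l.2
  simp only [Set.image_eq_range] at hsub hV
  refine exists_regular_curve_in_meet (K := fun l : L => D l) (δ := fun t l q => τ t q)
    rβ' rτ' hβ' hτ' ?_ (V := V) ?_ ?_ h0 h1
  · exact hsub.mono fun t ht l q => ht l l.2 q q.2
  · intro t
    rw [hV, iInf_subtype]
  · rw [ha]
    simp only [← Nat.card_eq_fintype_card, Nat.card_coe_set_eq]

section

universe u

variable {α : Type u}

/-! ### Realizations by families indexed by the ambient type -/

/-- On subsets of `X`, linear independence of the vectors `γ` is independence in `M`. -/
def RealizesOn (M : Matroid α) (X : Set α) {d : ℕ} (γ : α → Fin d → ℂ) : Prop :=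
  ∀ I ⊆ X, LinearIndepOn ℂ γ I ↔ M.Indep I

/-- The intersection of the spans of the subspaces through `p`. -/
def meet (M : Matroid α) {d : ℕ} (γ : α → Fin d → ℂ) (p : α) : Submodule ℂ (Fin d → ℂ) :=
  Submodule.span ℂ (γ '' M.E) ⊓ ⨅ l ∈ subspacesThrough M p, Submodule.span ℂ (γ '' points l)

/-- All points outside `P_M` are stable for the vectors `γ`. -/
def QuasiStable (M : Matroid α) {d : ℕ} (γ : α → Fin d → ℂ) : Prop :=
  ∀ p ∈ M.E, p ∉ criticalPoints M → (finrank ℂ (meet M γ p) : ℤ) = expectedDim M p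

/-- The vectors `γ` are a realization of `M`, quasi-stable on each member of the chain. -/
def Stable (M : Matroid α) {d : ℕ} (γ : α → Fin d → ℂ) : Prop :=
  RealizesOn M M.E γ ∧ ∀ j, QuasiStable (chain M j) γ

theorem criticalPoints_subset (M : Matroid α) : criticalPoints M ⊆ M.E := fun _ hp => hp.1

/-- The chain is defined by restricting its last member; the induction on solvability needs to split
off the first step instead. -/
theorem chain_succ_eq (M : Matroid α) (j : ℕ) :
    chain M (j + 1) = chain (M.restrict (criticalPoints M)) j := by
  induction j with
  | zero => rfl
  | succ j ih => rw [chain, ih, chain]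

theorem points_subset_ground {M : Matroid α} {l : Set (Set α)} (hl : l ∈ subspaces M) :
    points l ⊆ M.E := by
  obtain ⟨C, -, rfl⟩ := hl
  rintro p ⟨C', hC', hp⟩
  exact hC'.1.1.subset_ground hp

/-- A basis of `X ∩ P` is extended to one of `X`. Applied to a subspace, such a basis controls the
points already moving on the curve for `P` by its own members in `P`. -/
theorem exists_isBasis_inter {M : Matroid α} {X : Set α} (hX : X ⊆ M.E) (P : Set α) :
    ∃ D, M.IsBasis D X ∧ M.IsBasis (D ∩ P) (X ∩ P) := by
  obtain ⟨D', hD'⟩ := M.exists_isBasis (X ∩ P) (Set.inter_subset_left.trans hX)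
  obtain ⟨D, hD, hDD⟩ := hD'.indep.subset_isBasis_of_subset
    (hD'.subset.trans Set.inter_subset_left) hX
  refine ⟨D, hD, ?_⟩
  rwa [← hD'.eq_of_subset_indep (hD.indep.inter_right P)
    (Set.subset_inter hDD (hD'.subset.trans Set.inter_subset_right))
    (Set.inter_subset_inter_left P hD.subset)]

theorem ncard_eq_rank {M : Matroid α} {B : Set α} (hB : M.IsBasis B M.E) : B.ncard = rank M := by
  rw [rank, ← M.eRk_ground, ← hB.encard_eq_eRk, Set.ncard]

theorem ncard_eq_subspaceRank {M : Matroid α} {l : Set (Set α)} {D : Set α}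
    (hD : M.IsBasis D (points l)) : D.ncard = subspaceRank M l := by
  rw [subspaceRank, ← hD.encard_eq_eRk, Set.ncard]

/-! ### Spans of realizations and a criterion for realizing a matroid -/

section span

variable {d : ℕ} {v w : α → Fin d → ℂ} {s X : Set α}

theorem finrank_span_image_le (v : α → Fin d → ℂ) (hs : s.Finite) :
    finrank ℂ (Submodule.span ℂ (v '' s)) ≤ s.ncard := by
  have := hs.fintype
  rw [← Nat.card_coe_set_eq, Nat.card_eq_fintype_card, Set.image_eq_range]
  exact finrank_range_le_card _

theorem finrank_span_image_eq (hs : s.Finite) (hv : LinearIndepOn ℂ v s) :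
    finrank ℂ (Submodule.span ℂ (v '' s)) = s.ncard := by
  have := hs.fintype
  rw [← Nat.card_coe_set_eq, Nat.card_eq_fintype_card, Set.image_eq_range]
  exact finrank_span_eq_card hv.linearIndependent

theorem ncard_le_of_linearIndepOn {W : Submodule ℂ (Fin d → ℂ)} (hs : s.Finite)
    (hv : LinearIndepOn ℂ v s) (h : ∀ p ∈ s, v p ∈ W) : s.ncard ≤ finrank ℂ W := by
  rw [← finrank_span_image_eq hs hv]
  refine Submodule.finrank_mono (Submodule.span_le.2 ?_)
  rintro _ ⟨p, hp, rfl⟩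
  exact h p hp

/-- The independent vectors `v` on `s` lie in a span of dimension at most `|s|`, so they already
fill it. -/
theorem span_image_eq_of_linearIndepOn (hs : s.Finite) (hsX : s ⊆ X) (hv : LinearIndepOn ℂ v s)
    (h : ∀ p ∈ X, v p ∈ Submodule.span ℂ (w '' s)) :
    Submodule.span ℂ (v '' X) = Submodule.span ℂ (w '' s) := by
  refine le_antisymm ?_ ?_
  · rw [Submodule.span_le]
    rintro _ ⟨p, hp, rfl⟩
    exact h p hp
  · have hle : Submodule.span ℂ (v '' s) ≤ Submodule.span ℂ (w '' s) := by
      rw [Submodule.span_le]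
      rintro _ ⟨p, hp, rfl⟩
      exact h p (hsX hp)
    have heq := Submodule.eq_of_le_of_finrank_le hle <| by
      rw [finrank_span_image_eq hs hv]
      exact finrank_span_image_le w hs
    rw [← heq]
    exact Submodule.span_mono (Set.image_mono hsX)

theorem RealizesOn.mem_span {M : Matroid α} {P : Set α} (h : RealizesOn M P v) {D : Set α}
    (hD : M.IsBasis D X) (hX : X ⊆ P) {p : α} (hp : p ∈ X) :
    v p ∈ Submodule.span ℂ (v '' D) := by
  by_contra hc
  have hi := ((h D (hD.subset.trans hX)).2 hD.indep).insert hc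
  have hpD := hD.mem_of_insert_indep hp
    ((h _ (Set.insert_subset (hX hp) (hD.subset.trans hX))).1 hi)
  exact hc (Submodule.subset_span ⟨p, hpD, rfl⟩)

theorem RealizesOn.span_eq {M : Matroid α} {P : Set α} (h : RealizesOn M P v) {D : Set α}
    (hD : M.IsBasis D X) (hX : X ⊆ P) :
    Submodule.span ℂ (v '' X) = Submodule.span ℂ (v '' D) := by
  refine le_antisymm (Submodule.span_le.2 ?_) (Submodule.span_mono (Set.image_mono hD.subset))
  rintro _ ⟨p, hp, rfl⟩
  exact h.mem_span hD hX hp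

/-- Vectors lying in subspaces of the correct dimensions realize `M` as soon as they respect the
independent sets of `M`. -/
theorem realizesOn_of_mem {M : Matroid α} [M.Finite] {τ : α → Fin d → ℂ} {B : Set α}
    (hB : M.IsBasis B M.E) {W : Submodule ℂ (Fin d → ℂ)} (hW : finrank ℂ W ≤ B.ncard)
    {D : Set (Set α) → Set α} (hD : ∀ l ∈ subspaces M, M.IsBasis (D l) (points l))
    (hvW : ∀ p ∈ M.E, v p ∈ W)
    (hvD : ∀ l ∈ subspaces M, ∀ p ∈ points l, v p ∈ Submodule.span ℂ (τ '' D l))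
    (hI : ∀ I, M.Indep I → LinearIndepOn ℂ v I) : RealizesOn M M.E v := by
  refine fun I hIE => ⟨fun hv => ?_, hI I⟩
  by_contra hdep
  obtain ⟨C, hCI, hC⟩ := (show M.Dep I from ⟨hdep, hIE⟩).exists_isCircuit_subset
  have hvC := hv.mono hCI
  have hCfin : C.Finite := M.ground_finite.subset hC.subset_ground
  by_cases hsmall : C.encard < M.eRank + 1
  -- A small circuit lies in its own subspace `l`, whose span has dimension at most `|C| - 1`; a
  -- larger circuit has more than `rank M` elements, too many for `W`.
  · have hCs : C ∈ smallCircuits M := ⟨hC, hsmall⟩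
    have hl : {C' ∈ smallCircuits M | M.closure C' = M.closure C} ∈ subspaces M := ⟨C, hCs, rfl⟩
    set l := {C' ∈ smallCircuits M | M.closure C' = M.closure C}
    have hCl : C ∈ l := ⟨hCs, rfl⟩
    have hDl := hD l hl
    have hDfin : (D l).Finite := M.ground_finite.subset hDl.indep.subset_ground
    have h1 := ncard_le_of_linearIndepOn hCfin hvC
      fun p hp => hvD l hl p ⟨C, hCl, hp⟩
    have h2 := finrank_span_image_le τ hDfin
    have h3 : (D l).encard + 1 = C.encard := by
      rw [hDl.encard_eq_eRk, eRk_points_eq M hl hCl, hC.eRk_add_one_eq]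
    rw [← hDfin.cast_ncard_eq, ← hCfin.cast_ncard_eq] at h3
    norm_cast at h3
    omega
  · have h1 := ncard_le_of_linearIndepOn hCfin hvC fun p hp => hvW p (hC.subset_ground hp)
    have hBfin : B.Finite := M.ground_finite.subset hB.subset
    rw [not_lt, ← M.eRk_ground, ← hB.encard_eq_eRk, ← hBfin.cast_ncard_eq,
      ← hCfin.cast_ncard_eq] at hsmall
    norm_cast at hsmall
    omega

theorem quasiStable_congr {M : Matroid α} (h : Set.EqOn v w M.E) (hv : QuasiStable M v) :
    QuasiStable M w := by
  intro p hp hpc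
  have hm : meet M v p = meet M w p := by
    rw [meet, meet, h.image_eq]
    exact congrArg _ (iInf_congr fun l => iInf_congr fun hl => by
      rw [(h.mono (points_subset_ground hl.1)).image_eq])
  rw [← hm, hv p hp hpc]

end span

theorem RealizesOn.meet_eq {M : Matroid α} {d : ℕ} {v β τ : α → Fin d → ℂ}
    (h : RealizesOn M M.E v) {B : Set α} (hB : M.IsBasis B M.E) {D : Set (Set α) → Set α}
    (hD : ∀ l ∈ subspaces M, M.IsBasis (D l) (points l)) (hβ : Set.EqOn β v M.E)
    (hτ : Set.EqOn τ v M.E) (p : α) :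
    Submodule.span ℂ (β '' B) ⊓ ⨅ l ∈ subspacesThrough M p, Submodule.span ℂ (τ '' D l) =
      meet M v p := by
  rw [meet, h.span_eq hB subset_rfl, (hβ.mono hB.subset).image_eq]
  exact congrArg _ (iInf_congr fun l => iInf_congr fun hl => by
    rw [h.span_eq (hD l hl.1) (points_subset_ground hl.1),
      (hτ.mono (hD l hl.1).indep.subset_ground).image_eq])

theorem expectedDim_eq {M : Matroid α} [M.Finite] (p : α) [Fintype (subspacesThrough M p)]
    {B : Set α} (hB : M.IsBasis B M.E) {D : Set (Set α) → Set α}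
    (hD : ∀ l ∈ subspaces M, M.IsBasis (D l) (points l)) :
    expectedDim M p = ∑ l : subspacesThrough M p, ((D l).ncard : ℤ) -
      B.ncard * ((Fintype.card (subspacesThrough M p) : ℤ) - 1) := by
  rw [expectedDim, ← finsum_set_coe_eq_finsum_mem, finsum_eq_sum_of_fintype, ncard_eq_rank hB,
    ← Nat.card_coe_set_eq, Nat.card_eq_fintype_card]
  congr 1
  exact Finset.sum_congr rfl fun l _ => by rw [ncard_eq_subspaceRank (hD l l.2.1)]

theorem Stable.restrict {M : Matroid α} {d : ℕ} {v : α → Fin d → ℂ} (h : Stable M v) :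
    Stable (M.restrict (criticalPoints M)) v := by
  refine ⟨fun I hI => ?_, fun j => ?_⟩
  · rw [Matroid.restrict_indep_iff, h.1 I (hI.trans (criticalPoints_subset M))]
    exact ⟨fun h => ⟨h, hI⟩, fun h => h.1⟩
  · rw [← chain_succ_eq]
    exact h.2 (j + 1)

/-! ### Extending curves from `P_M` to `M` -/

/-- A regular curve of realizations of the submatroid `P_M` extends to a regular curve of
quasi-stable realizations of `M` with prescribed end points. -/
theorem exists_quasiStable_extension (M : Matroid α) [M.Finite] {d : ℕ} {x y : α → Fin d → ℂ}
    (rx : RealizesOn M M.E x) (ry : RealizesOn M M.E y) (qx : QuasiStable M x)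
    (qy : QuasiStable M y) {c : ℂ → α → Fin d → ℂ} (rc : ∀ p j, IsReg fun t => c t p j)
    (c0 : Set.EqOn (c 0) x (criticalPoints M)) (c1 : Set.EqOn (c 1) y (criticalPoints M))
    (hc : ∀ᶠ t in endsFilter, RealizesOn M (criticalPoints M) (c t)) :
    ∃ γ : ℂ → α → Fin d → ℂ, (∀ p j, IsReg fun t => γ t p j) ∧ Set.EqOn (γ 0) x M.E ∧
      Set.EqOn (γ 1) y M.E ∧ (∀ t, Set.EqOn (γ t) (c t) (criticalPoints M)) ∧
      ∀ᶠ t in endsFilter, RealizesOn M M.E (γ t) ∧ QuasiStable M (γ t) := by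
  classical
  set P := criticalPoints M with hP
  have hPE : P ⊆ M.E := criticalPoints_subset M
  obtain ⟨B, hB, hBP⟩ := exists_isBasis_inter (M := M) subset_rfl P
  rw [Set.inter_eq_self_of_subset_right hPE] at hBP
  have hBfin : B.Finite := M.ground_finite.subset hB.subset
  have hD' : ∀ l : Set (Set α), ∃ D, l ∈ subspaces M →
      M.IsBasis D (points l) ∧ M.IsBasis (D ∩ P) (points l ∩ P) := by
    intro l
    by_cases hl : l ∈ subspaces M
    · obtain ⟨D, hD⟩ := exists_isBasis_inter (points_subset_ground hl) P
      exact ⟨D, fun _ => hD⟩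
    · exact ⟨∅, fun h => absurd h hl⟩
  choose D hDl using hD'
  have hD : ∀ l ∈ subspaces M, M.IsBasis (D l) (points l) := fun l hl => (hDl l hl).1
  have hDfin : ∀ l ∈ subspaces M, (D l).Finite :=
    fun l hl => M.ground_finite.subset (hD l hl).indep.subset_ground
  -- a moving basis of the span
  let β : ℂ → α → Fin d → ℂ := fun t b =>
    if b ∈ P then c t b else fun j => (1 - t) * x b j + t * y b j
  have rβ : ∀ b j, IsReg fun t => β t b j := by
    intro b j
    by_cases hb : b ∈ P
    · simpa only [β, if_pos hb] using rc b j
    · simpa only [β, if_neg hb] using IsReg.lerp (x b j) (y b j)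
  have β0 : β 0 = x := by
    ext b j
    by_cases hb : b ∈ P
    · simp [β, hb, c0 hb]
    · simp [β, hb]
  have β1 : β 1 = y := by
    ext b j
    by_cases hb : b ∈ P
    · simp [β, hb, c1 hb]
    · simp [β, hb]
  have hβ : ∀ᶠ t in endsFilter, LinearIndepOn ℂ (β t) B :=
    eventually_linearIndepOn hBfin (fun b _ => rβ b)
      (by rw [β0]; exact (rx B hB.subset).2 hB.indep)
      (by rw [β1]; exact (ry B hB.subset).2 hB.indep)
  -- moving bases of the subspaces
  have hu : ∀ q, ∃ v : ℂ → Fin d → ℂ, q ∈ M.E → (∀ j, IsReg fun t => v t j) ∧ v 0 = x q ∧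
      v 1 = y q ∧ ∀ t, v t ∈ Submodule.span ℂ (β t '' B) := by
    intro q
    by_cases hq : q ∈ M.E
    · obtain ⟨v, hv⟩ := exists_regular_curve_in_span (s := B) (fun b _ => rβ b)
        (by rw [β0]; exact rx.mem_span hB subset_rfl hq)
        (by rw [β1]; exact ry.mem_span hB subset_rfl hq)
      exact ⟨v, fun _ => hv⟩
    · exact ⟨0, fun h => absurd h hq⟩
  choose u hu using hu
  -- Off `P` these are auxiliary vectors: `τ t q` need not lie in every subspace through `q`, and
  -- only the spans of the families on `D l` matter. The actual position of `q` is chosen later.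
  let τ : ℂ → α → Fin d → ℂ := fun t q => if q ∈ P then c t q else u q t
  have rτ : ∀ q ∈ M.E, ∀ j, IsReg fun t => τ t q j := by
    intro q hq j
    by_cases hqP : q ∈ P
    · simpa only [τ, if_pos hqP] using rc q j
    · simpa only [τ, if_neg hqP] using (hu q hq).1 j
  have τ0 : Set.EqOn (τ 0) x M.E := by
    intro q hq
    by_cases hqP : q ∈ P
    · simp only [τ, if_pos hqP, c0 hqP]
    · simp only [τ, if_neg hqP, (hu q hq).2.1]
  have τ1 : Set.EqOn (τ 1) y M.E := by
    intro q hq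
    by_cases hqP : q ∈ P
    · simp only [τ, if_pos hqP, c1 hqP]
    · simp only [τ, if_neg hqP, (hu q hq).2.2.1]
  -- `B ∩ P` is a basis of `P` and `c t` realizes `M` on `P`, so the points of `P` stay in the
  -- moving span; the same argument works for each subspace with `D l ∩ P`.
  have hcB : ∀ᶠ t in endsFilter, ∀ p ∈ P, c t p ∈ Submodule.span ℂ (β t '' B) := by
    filter_upwards [hc] with t ht p hp
    refine Submodule.span_mono ?_ (ht.mem_span hBP subset_rfl hp)
    rintro _ ⟨b, hb, rfl⟩
    exact ⟨b, hb.1, if_pos hb.2⟩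
  have hcD : ∀ᶠ t in endsFilter, ∀ l ∈ subspaces M, ∀ p ∈ points l, p ∈ P →
      c t p ∈ Submodule.span ℂ (τ t '' D l) := by
    filter_upwards [hc] with t ht l hl p hpl hpP
    refine Submodule.span_mono ?_
      (ht.mem_span (hDl l hl).2 Set.inter_subset_right ⟨hpl, hpP⟩)
    rintro _ ⟨b, hb, rfl⟩
    exact ⟨b, hb.1, if_pos hb.2⟩
  have hτB : ∀ᶠ t in endsFilter, ∀ q ∈ M.E, τ t q ∈ Submodule.span ℂ (β t '' B) := by
    filter_upwards [hcB] with t ht q hq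
    by_cases hqP : q ∈ P
    · simpa only [τ, if_pos hqP] using ht q hqP
    · simpa only [τ, if_neg hqP] using (hu q hq).2.2.2 t
  have hτD : ∀ᶠ t in endsFilter, ∀ l ∈ subspaces M, LinearIndepOn ℂ (τ t) (D l) := by
    rw [eventually_all_finite (finite_subspaces M)]
    intro l hl
    have hDE := (hD l hl).indep.subset_ground
    refine eventually_linearIndepOn (hDfin l hl) (fun q hq => rτ q (hDE hq)) ?_ ?_
    · exact (linearIndepOn_congr (τ0.mono hDE)).2 ((rx _ hDE).2 (hD l hl).indep)
    · exact (linearIndepOn_congr (τ1.mono hDE)).2 ((ry _ hDE).2 (hD l hl).indep)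
  -- moving the points outside `P`
  let V : ℂ → α → Submodule ℂ (Fin d → ℂ) := fun t p => Submodule.span ℂ (β t '' B) ⊓
    ⨅ l ∈ subspacesThrough M p, Submodule.span ℂ (τ t '' D l)
  have V0 : ∀ p, V 0 p = meet M x p := fun p => rx.meet_eq hB hD (fun q _ => by rw [β0]) τ0 p
  have V1 : ∀ p, V 1 p = meet M y p := fun p => ry.meet_eq hB hD (fun q _ => by rw [β1]) τ1 p
  have hV : ∀ p ∈ M.E, p ∉ P →
      (∀ᶠ t in endsFilter, (finrank ℂ (V t p) : ℤ) = expectedDim M p) ∧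
      ∀ v₀ ∈ V 0 p, ∀ v₁ ∈ V 1 p, ∃ v : ℂ → Fin d → ℂ, (∀ j, IsReg fun t => v t j) ∧
        v 0 = v₀ ∧ v 1 = v₁ ∧ ∀ᶠ t in endsFilter, v t ∈ V t p := by
    intro p hp hpP
    have := (finite_subspacesThrough M p).fintype
    refine exists_regular_curve_in_meet_image hBfin (fun l hl => hDfin l hl.1)
      (fun b _ => rβ b) (fun l hl q hq => rτ q ((hD l hl.1).indep.subset_ground hq)) hβ
      (hτD.mono fun t ht l hl => ht l hl.1)
      (hτB.mono fun t ht l hl q hq => ht q ((hD l hl.1).indep.subset_ground hq))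
      (V := fun t => V t p) (fun _ => rfl) (expectedDim_eq p hB hD) ?_ ?_
    · rw [V0]
      exact qx p hp hpP
    · rw [V1]
      exact qy p hp hpP
  have hmem : ∀ {z : α → Fin d → ℂ}, ∀ p ∈ M.E, z p ∈ meet M z p := by
    intro z p hp
    simp only [meet, Submodule.mem_inf, Submodule.mem_iInf]
    exact ⟨Submodule.subset_span ⟨p, hp, rfl⟩, fun l hl => Submodule.subset_span ⟨p, hl.2, rfl⟩⟩
  have hv : ∀ p, ∃ v : ℂ → Fin d → ℂ, p ∈ M.E → p ∉ P → (∀ j, IsReg fun t => v t j) ∧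
      v 0 = x p ∧ v 1 = y p ∧ ∀ᶠ t in endsFilter, v t ∈ V t p := by
    intro p
    by_cases hp : p ∈ M.E
    · by_cases hpP : p ∈ P
      · exact ⟨0, fun _ h => absurd hpP h⟩
      · obtain ⟨v, hv⟩ := (hV p hp hpP).2 (x p) (V0 p ▸ hmem p hp) (y p) (V1 p ▸ hmem p hp)
        exact ⟨v, fun _ _ => hv⟩
    · exact ⟨0, fun h => absurd h hp⟩
  choose v hv using hv
  let γ : ℂ → α → Fin d → ℂ := fun t p => if p ∈ P then c t p else if p ∈ M.E then v p t else 0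
  have γP : ∀ t, Set.EqOn (γ t) (c t) P := fun t p hp => if_pos hp
  have γE : ∀ t, ∀ p ∈ M.E, p ∉ P → γ t p = v p t := fun t p hp hpP => by
    simp only [γ, if_neg hpP, if_pos hp]
  have rγ : ∀ p j, IsReg fun t => γ t p j := by
    intro p j
    by_cases hpP : p ∈ P
    · simpa only [γP _ hpP] using rc p j
    · by_cases hp : p ∈ M.E
      · simpa only [γE _ p hp hpP] using (hv p hp hpP).1 j
      · simpa only [γ, if_neg hpP, if_neg hp] using IsReg.const ((0 : Fin d → ℂ) j)
  have γ0 : Set.EqOn (γ 0) x M.E := by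
    intro p hp
    by_cases hpP : p ∈ P
    · rw [γP _ hpP, c0 hpP]
    · rw [γE _ p hp hpP, (hv p hp hpP).2.1]
  have γ1 : Set.EqOn (γ 1) y M.E := by
    intro p hp
    by_cases hpP : p ∈ P
    · rw [γP _ hpP, c1 hpP]
    · rw [γE _ p hp hpP, (hv p hp hpP).2.2.1]
  refine ⟨γ, rγ, γ0, γ1, γP, ?_⟩
  -- Finitely many independent sets have to be preserved, each for almost all `t` since it is
  -- independent at both ends.
  have hI : ∀ᶠ t in endsFilter, ∀ I ∈ {I | M.Indep I}, LinearIndepOn ℂ (γ t) I := by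
    rw [eventually_all_finite (M.ground_finite.finite_subsets.subset fun I hI => hI.subset_ground)]
    intro I hI
    have hIE := Matroid.Indep.subset_ground hI
    refine eventually_linearIndepOn (M.ground_finite.subset hIE) (fun q _ => rγ q) ?_ ?_
    · exact (linearIndepOn_congr (γ0.mono hIE)).2 ((rx _ hIE).2 hI)
    · exact (linearIndepOn_congr (γ1.mono hIE)).2 ((ry _ hIE).2 hI)
  have hvV : ∀ᶠ t in endsFilter, ∀ p ∈ M.E, p ∉ P →
      v p t ∈ V t p ∧ (finrank ℂ (V t p) : ℤ) = expectedDim M p := by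
    rw [eventually_all_finite M.ground_finite]
    intro p hp
    by_cases hpP : p ∈ P
    · exact Eventually.of_forall fun t h => absurd hpP h
    · filter_upwards [(hv p hp hpP).2.2.2, (hV p hp hpP).1] with t h h' _
      exact ⟨h, h'⟩
  filter_upwards [hI, hvV, hcB, hcD] with t hI hvV hcB hcD
  have hγB : ∀ p ∈ M.E, γ t p ∈ Submodule.span ℂ (β t '' B) := by
    intro p hp
    by_cases hpP : p ∈ P
    · rw [γP t hpP]
      exact hcB p hpP
    · rw [γE t p hp hpP]
      exact (hvV p hp hpP).1.1
  have hγD : ∀ l ∈ subspaces M, ∀ p ∈ points l, γ t p ∈ Submodule.span ℂ (τ t '' D l) := by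
    intro l hl p hpl
    have hp := points_subset_ground hl hpl
    by_cases hpP : p ∈ P
    · rw [γP t hpP]
      exact hcD l hl p hpl hpP
    · rw [γE t p hp hpP]
      have h := (hvV p hp hpP).1.2
      simp only [SetLike.mem_coe, Submodule.mem_iInf] at h
      exact h l ⟨hl, hpl⟩
  have hreal := realizesOn_of_mem hB (finrank_span_image_le _ hBfin) hD hγB hγD hI
  refine ⟨hreal, fun p hp hpP => ?_⟩
  -- The points of `γ t` span exactly the auxiliary spaces, so their intersection at `p` is `V t p`,
  -- of known dimension.
  rw [← (hvV p hp hpP).2, meet,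
    span_image_eq_of_linearIndepOn hBfin hB.subset (hI B hB.indep) hγB]
  have hm : ∀ l ∈ subspacesThrough M p,
      Submodule.span ℂ (γ t '' points l) = Submodule.span ℂ (τ t '' D l) := fun l hl =>
    span_image_eq_of_linearIndepOn (hDfin l hl.1) (hD l hl.1).subset
      (hI _ (hD l hl.1).indep) (hγD l hl.1)
  rw [iInf_congr fun l => iInf_congr fun hl => hm l hl]

/-- Stable realizations of a solvable matroid are joined by regular curves of stable
realizations. -/
theorem exists_stable_curve {d : ℕ} (k : ℕ) : ∀ (M : Matroid α) [M.Finite], (chain M k).E = ∅ →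
    ∀ x y : α → Fin d → ℂ, Stable M x → Stable M y →
      ∃ γ : ℂ → α → Fin d → ℂ, (∀ p j, IsReg fun t => γ t p j) ∧ Set.EqOn (γ 0) x M.E ∧
        Set.EqOn (γ 1) y M.E ∧ ∀ᶠ t in endsFilter, Stable M (γ t) := by
  induction k with
  | zero =>
    intro M _ hM x y hx hy
    replace hM : M.E = ∅ := hM
    refine ⟨fun _ _ _ => 0, fun _ _ => IsReg.const 0, by simp [hM], by simp [hM],
      Eventually.of_forall fun t => ⟨fun I hI => ?_, fun j p hp => ?_⟩⟩
    · obtain rfl : I = ∅ := by simpa [hM] using hI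
      simp
    · have := chain_ground_subset M j hp
      simp [hM] at this
  | succ k ih =>
    intro M _ hM x y hx hy
    have : (M.restrict (criticalPoints M)).Finite :=
      Matroid.restrict_finite (M.ground_finite.subset (criticalPoints_subset M))
    rw [chain_succ_eq] at hM
    obtain ⟨c, rc, c0, c1, hc⟩ := ih _ hM x y hx.restrict hy.restrict
    obtain ⟨γ, rγ, γ0, γ1, γc, hγ⟩ := exists_quasiStable_extension M hx.1 hy.1 (hx.2 0) (hy.2 0) rc
      c0 c1 <| hc.mono fun t ht I hI => by
        rw [ht.1 I hI, Matroid.restrict_indep_iff, and_iff_left hI]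
    refine ⟨γ, rγ, γ0, γ1, ?_⟩
    filter_upwards [hc, hγ] with t ht ht'
    refine ⟨ht'.1, fun j => ?_⟩
    -- The first member of the chain is handled by the extension; the later ones only see points of
    -- `P_M`, where `γ t` agrees with `c t`.
    cases j with
    | zero => exact ht'.2
    | succ j =>
      rw [chain_succ_eq]
      exact quasiStable_congr
        ((γc t).symm.mono (chain_ground_subset (M.restrict (criticalPoints M)) j)) (ht.2 j)

/-! ### Passage to collections indexed by the ground set, and irreducibility -/

theorem mem_realizations_iff {M : Matroid α} {d : ℕ} (g : α → Fin d → ℂ) :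
    (fun p : M.E => g p) ∈ realizations M d ↔ RealizesOn M M.E g := by
  have key : ∀ I : Set M.E, LinearIndepOn ℂ (fun p : M.E => g p) I ↔
      LinearIndepOn ℂ g (Subtype.val '' I) := fun I =>
    linearIndependent_equiv' (Equiv.Set.image _ I Subtype.val_injective) rfl
  constructor
  · intro h I hI
    have hI' : Subtype.val '' (Subtype.val ⁻¹' I : Set M.E) = I := by
      rw [Subtype.image_preimage_coe, Set.inter_eq_self_of_subset_right hI]
    rw [← hI', ← key, h]
  · intro h I
    rw [key, h _ (Subtype.coe_image_subset _ _)]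

theorem meetAt_eq {N : Matroid α} {d : ℕ} (g : α → Fin d → ℂ) (p : α) :
    meetAt (fun q : N.E => g q) p = meet N g p := by
  have h : ∀ X ⊆ N.E, (fun q : N.E => g q) '' {q | (q : α) ∈ X} = g '' X := by
    intro X hX
    ext v
    constructor
    · rintro ⟨q, hq, rfl⟩
      exact ⟨q, hq, rfl⟩
    · rintro ⟨q, hq, rfl⟩
      exact ⟨⟨q, hX hq⟩, hq, rfl⟩
  rw [meetAt, meet, Set.image_eq_range]
  exact congrArg _ (iInf_congr fun l => iInf_congr fun hl => by
    rw [spanOf, h _ (points_subset_ground hl.1)])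

theorem mem_stableRealizations_iff {M : Matroid α} (g : α → Fin (rank M) → ℂ) :
    (fun p : M.E => g p) ∈ stableRealizations M ↔ Stable M g := by
  refine and_congr (mem_realizations_iff g) (forall_congr' fun j => ?_)
  refine forall₃_congr fun p hp hpc => ?_
  rw [IsStableAt, ← meetAt_eq (N := chain M j)]
  rfl

end

/-- The stable realizations of a solvable matroid form a preirreducible set. -/
theorem isPreirreducible_stableRealizations {α : Type*} (M : Matroid α) [M.Finite]
    (hM : IsSolvable M) :
    @IsPreirreducible _ (zariskiTopology M.E (Fin (rank M))) (stableRealizations M) := by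
  let := zariskiTopology M.E (Fin (rank M))
  have hopen : ∀ U : Set (M.E → Fin (rank M) → ℂ), IsOpen U → ∀ z ∈ U,
      ∃ f : MvPolynomial (M.E × Fin (rank M)) ℂ,
        MvPolynomial.eval (fun ij => z ij.1 ij.2) f ≠ 0 ∧
        ∀ w, MvPolynomial.eval (fun ij => w ij.1 ij.2) f ≠ 0 → w ∈ U := by
    intro U hU z hz
    obtain ⟨S, hS⟩ : Uᶜ ∈ {Z | ∃ S : Set (MvPolynomial (M.E × Fin (rank M)) ℂ), Z = zeroSet S} :=
      hU
    have hzS : z ∉ zeroSet S := by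
      rw [← hS]
      exact fun h => h hz
    simp only [zeroSet, Set.mem_ofPred_eq, not_forall] at hzS
    obtain ⟨f, hfS, hf⟩ := hzS
    refine ⟨f, hf, fun w hw => ?_⟩
    by_contra hwU
    have hw' : w ∈ zeroSet S := hS ▸ hwU
    exact hw (hw' f hfS)
  have hext : ∀ z : M.E → Fin (rank M) → ℂ, ∃ g : α → Fin (rank M) → ℂ, (fun p : M.E => g p) = z := by
    classical
    exact fun z => ⟨fun p => if h : p ∈ M.E then z ⟨p, h⟩ else 0, by ext; simp⟩
  rintro U V hU hV ⟨x, hx, hxU⟩ ⟨y, hy, hyV⟩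
  obtain ⟨f, hfx, hf⟩ := hopen U hU x hxU
  obtain ⟨g, hgy, hg⟩ := hopen V hV y hyV
  obtain ⟨x, rfl⟩ := hext x
  obtain ⟨y, rfl⟩ := hext y
  rw [mem_stableRealizations_iff] at hx hy
  obtain ⟨k, hk⟩ := hM
  obtain ⟨γ, rγ, γ0, γ1, hγ⟩ := exists_stable_curve k M hk x y hx hy
  have hreg : ∀ h : MvPolynomial (M.E × Fin (rank M)) ℂ,
      IsReg fun t => MvPolynomial.eval (fun ij : M.E × Fin (rank M) => γ t ij.1 ij.2) h :=
    fun h => IsReg.eval h fun ij => rγ _ _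
  -- `f` is nonzero at the end `t = 0` and `g` at the end `t = 1`; one end suffices for each.
  have hf' := (hreg f).eventually_ne <| Or.inl <| by
    convert hfx using 4 with ij
    exact congrFun (γ0 ij.1.2) ij.2
  have hg' := (hreg g).eventually_ne <| Or.inr <| by
    convert hgy using 4 with ij
    exact congrFun (γ1 ij.1.2) ij.2
  obtain ⟨t, hft, hgt, ht⟩ := (hf'.and (hg'.and (eventually_endsFilter.1 hγ).1)).exists
  exact ⟨fun p => γ t p, (mem_stableRealizations_iff _).2 ht, hf _ hft, hg _ hgt⟩

end SolvableMatroid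

theorem mainTheorem5 {α : Type*} (M : Matroid α) [M.Finite]
    (hM : SolvableMatroid.IsSolvable M) :
    @IsIrreducible _ (SolvableMatroid.zariskiTopology M.E (Fin (SolvableMatroid.rank M)))
        (SolvableMatroid.stableRealizations M) ∨
      SolvableMatroid.stableRealizations M = ∅ := by
  rcases (SolvableMatroid.stableRealizations M).eq_empty_or_nonempty with h | h
  · exact Or.inr h
  · exact Or.inl ⟨h, SolvableMatroid.isPreirreducible_stableRealizations M hM⟩
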